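/- Consider online fractional covering with variables $x\in\mathbb R^n_{\ge 0}$. A matrix $B\in\mathbb R_{\ge 0}^{K\times n}$ (the $K$ packing constraints, with load vector $Bx$) and an integer $d$ are given up front. Covering constraints $a_t^{\top}x\ge 1$, $t=1,2,\dots$, arrive one at a time; each row $a_t\in\mathbb R^n_{\ge 0}$ is non-zero and has at most $d$ non-zero entries. After each arrival a deterministic online algorithm, knowing only $B$, $d$, the objective and the rows that have arrived so far, must hold a solution $x\ge 0$ satisfying all constraints that have arrived, and no coordinate of $x$ may ever decrease. For an objective $f:\mathbb R^n_{\ge0}\to\mathbb R_{\ge 0}$ the algorithm is called $c$-competitive if, for every finite sequence of arrivals, its current solution $x$ satisfies $f(x)\le c\cdot f(z)$ for every $z\ge 0$ that satisfies all constraints that have arrived. There is an absolute constant $C>0$ such that the following hold. 1. For all real $p\ge 1$, all $n,K,d$ and every non-negative $K\times n$ matrix $B$ there is a $\bigl(C\,p\log(1+d)\bigr)$-competitive online algorithm for the objective $f(x)=\|Bx\|_p=\bigl(\sum_{k=1}^K (B_kx)^p\bigr)^{1/p}$, where $B_k$ is the $k$-th row of $B$. 2. For all $n,d$, all $K\ge1$,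 all real $p_1,\dots,p_K\ge 1$ with $p=\max_k p_k$, and every non-negative $K\times n$ matrix $B$ there is a $\bigl(C\,p\log(1+d)\bigr)^p$-competitive online algorithm for the objective $f(x)=\sum_{k=1}^K (B_kx)^{p_k}$ (equivalently, one that is $C\,p\log(1+d)$-competitive for $f(x)^{1/p}$). -/

import Mathlib

open scoped Matrix

namespace OnlineCovering

/-- A covering constraint `a ⬝ᵥ x ≥ 1` that may arrive: the row `a` is non-negative, it is not
identically zero (otherwise no `x` satisfies the constraint), and it has at most `d` non-zero
entries. -/
structure IsRow {n : ℕ} (d : ℕ) (a : Fin n → ℝ) : Prop where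
  nonneg : ∀ j, 0 ≤ a j
  ne_zero : a ≠ 0
  sparse : {j | a j ≠ 0}.ncard ≤ d

/-- `x` is a fractional solution of the covering constraints whose rows are listed in `rows`:
`A x ≥ 1` and `x ≥ 0`. -/
structure IsFeasible {n : ℕ} (rows : List (Fin n → ℝ)) (x : Fin n → ℝ) : Prop where
  nonneg : ∀ j, 0 ≤ x j
  covers : ∀ a ∈ rows, 1 ≤ a ⬝ᵥ x

/-- A deterministic online algorithm: its current solution is a function of the list of rows
that have arrived up to now (in order of arrival), hence does not depend on future rows. -/
abbrev Algorithm (n : ℕ) : Type := List (Fin n → ℝ) → Fin n → ℝ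

/-- `alg` is a `c`-competitive online algorithm for minimising `f` subject to covering constraints
of row sparsity at most `d`. After every finite sequence of arrivals the current solution is
feasible, it never decreases in any coordinate when a further row arrives, and its cost is at
most `c` times the cost of every offline solution of the constraints that have arrived. -/
structure IsCompetitive {n : ℕ} (d : ℕ) (f : (Fin n → ℝ) → ℝ) (c : ℝ) (alg : Algorithm n) :
    Prop where
  feasible : ∀ rows : List (Fin n → ℝ), (∀ a ∈ rows, IsRow d a) → IsFeasible rows (alg rows)
  monotone : ∀ rows : List (Fin n → ℝ), (∀ a ∈ rows, IsRow d a) →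
    ∀ a, IsRow d a → ∀ j, alg rows j ≤ alg (rows ++ [a]) j
  competitive : ∀ rows : List (Fin n → ℝ), (∀ a ∈ rows, IsRow d a) →
    ∀ z, IsFeasible rows z → f (alg rows) ≤ c * f z

/-- The `ℓ_p`-norm of the load vector `B x`. -/
noncomputable def loadNorm {K n : ℕ} (p : ℝ) (B : Matrix (Fin K) (Fin n) ℝ)
    (x : Fin n → ℝ) : ℝ :=
  ‖WithLp.toLp (ENNReal.ofReal p) (B *ᵥ x)‖

/-- The sum of (possibly different) powers of the loads, `∑ k, (B_k x) ^ (q k)`. -/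
noncomputable def loadPowerSum {K n : ℕ} (q : Fin K → ℝ) (B : Matrix (Fin K) (Fin n) ℝ)
    (x : Fin n → ℝ) : ℝ :=
  ∑ k, ((B *ᵥ x) k) ^ (q k)

end OnlineCovering

namespace OnlineCovering

/-! The proof is a primal potential-function argument. Write `f` for `loadPowerSum q B`; it is
convex with a coordinatewise monotone gradient. While a row `a` is violated, move along `v j = (a j
* x j + 1 / d) / ∇_j f(x)` on the support of `a`. The cost then grows at rate at most `a ⬝ᵥ x + 1 ≤
2`, while `potential` grows at a constant rate for every `w ≥ 0` with `a ⬝ᵥ w ≥ 2` at once, in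
particular for `w = 2 • z` with `z` any offline solution. As each logarithm is at most `2 * log (1 +
d)`, this gives `f x ≤ f z + 32 * log (1 + d) * ⟨∇f(x), z⟩`. A Young-type inequality absorbs half of
`f x` and leaves the factor `(128 * p * log (1 + d)) ^ p`; part 1 follows by taking a `p`-th root.
No differential equation is solved: `exists_short_step` gives a small discrete move, and
`exists_covering_step` replaces the flow by a maximum over a compact set. Zero gradients are avoided
by raising zero columns of `B` for free and by a small positive start. -/

/-- The gradient of `loadPowerSum q B` at a non-negative point. -/
noncomputable def loadGradient {K n : ℕ} (q : Fin K → ℝ) (B : Matrix (Fin K) (Fin n) ℝ)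
    (x : Fin n → ℝ) (j : Fin n) : ℝ :=
  ∑ k, q k * (B *ᵥ x) k ^ (q k - 1) * B k j

/-- A potential measuring the progress of `x` towards a comparison vector `w`. -/
noncomputable def potential {K n : ℕ} (d : ℕ) (q : Fin K → ℝ) (B : Matrix (Fin K) (Fin n) ℝ)
    (w x : Fin n → ℝ) : ℝ :=
  ∑ j, w j * loadGradient q B x j * Real.log (1 + d * min (x j) (2 * w j) / w j)

/-! ### Monotonicity, convexity and continuity of the objective and the potential. -/

section Basic

variable {K n : ℕ} {d : ℕ} {q : Fin K → ℝ} {B : Matrix (Fin K) (Fin n) ℝ}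

lemma mulVec_nonneg (hB : ∀ k j, 0 ≤ B k j) {x : Fin n → ℝ} (hx : ∀ j, 0 ≤ x j) (k : Fin K) :
    0 ≤ (B *ᵥ x) k := by
  unfold Matrix.mulVec dotProduct
  exact Finset.sum_nonneg fun j _ => mul_nonneg (hB k j) (hx j)

lemma mulVec_mono (hB : ∀ k j, 0 ≤ B k j) {x y : Fin n → ℝ} (hxy : x ≤ y) (k : Fin K) :
    (B *ᵥ x) k ≤ (B *ᵥ y) k := by
  unfold Matrix.mulVec dotProduct
  exact Finset.sum_le_sum fun j _ => mul_le_mul_of_nonneg_left (hxy j) (hB k j)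

lemma mul_le_mulVec (hB : ∀ k j, 0 ≤ B k j) {x : Fin n → ℝ} (hx : ∀ j, 0 ≤ x j)
    (k : Fin K) (j : Fin n) : B k j * x j ≤ (B *ᵥ x) k :=
  Finset.single_le_sum (f := fun i => B k i * x i) (fun i _ => mul_nonneg (hB k i) (hx i))
    (Finset.mem_univ j)

lemma continuous_mulVec_apply (k : Fin K) : Continuous fun x : Fin n → ℝ => (B *ᵥ x) k := by
  unfold Matrix.mulVec dotProduct
  fun_prop

lemma continuous_loadPowerSum (hq : ∀ k, 1 ≤ q k) : Continuous (loadPowerSum q B) :=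
  continuous_finsetSum _ fun k _ =>
    (continuous_mulVec_apply k).rpow_const fun _ => Or.inr (by linarith [hq k])

lemma continuous_loadGradient (hq : ∀ k, 1 ≤ q k) (j : Fin n) :
    Continuous fun x => loadGradient q B x j :=
  continuous_finsetSum _ fun k _ =>
    (continuous_const.mul ((continuous_mulVec_apply k).rpow_const
      fun _ => Or.inr (by linarith [hq k]))).mul continuous_const

lemma loadPowerSum_nonneg (hB : ∀ k j, 0 ≤ B k j) {x : Fin n → ℝ} (hx : ∀ j, 0 ≤ x j) :
    0 ≤ loadPowerSum q B x :=
  Finset.sum_nonneg fun k _ => Real.rpow_nonneg (mulVec_nonneg hB hx k) _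

lemma loadPowerSum_eq_zero (hq : ∀ k, 1 ≤ q k) {x : Fin n → ℝ} (hx : B *ᵥ x = 0) :
    loadPowerSum q B x = 0 :=
  Finset.sum_eq_zero fun k _ => by
    rw [hx, Pi.zero_apply, Real.zero_rpow (by linarith [hq k])]

lemma loadGradient_nonneg (hq : ∀ k, 1 ≤ q k) (hB : ∀ k j, 0 ≤ B k j) {x : Fin n → ℝ}
    (hx : ∀ j, 0 ≤ x j) (j : Fin n) : 0 ≤ loadGradient q B x j :=
  Finset.sum_nonneg fun k _ =>
    mul_nonneg (mul_nonneg (by linarith [hq k]) (Real.rpow_nonneg (mulVec_nonneg hB hx k) _))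
      (hB k j)

lemma loadGradient_mono (hq : ∀ k, 1 ≤ q k) (hB : ∀ k j, 0 ≤ B k j) {x y : Fin n → ℝ}
    (hx : ∀ j, 0 ≤ x j) (hxy : x ≤ y) (j : Fin n) :
    loadGradient q B x j ≤ loadGradient q B y j :=
  Finset.sum_le_sum fun k _ =>
    mul_le_mul_of_nonneg_right (mul_le_mul_of_nonneg_left
      (Real.rpow_le_rpow (mulVec_nonneg hB hx k) (mulVec_mono hB hxy k) (by linarith [hq k]))
      (by linarith [hq k])) (hB k j)

lemma loadGradient_pos (hq : ∀ k, 1 ≤ q k) (hB : ∀ k j, 0 ≤ B k j) {x : Fin n → ℝ}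
    (hx : ∀ j, 0 < x j) {j : Fin n} (hj : ∃ k, B k j ≠ 0) : 0 < loadGradient q B x j := by
  obtain ⟨k, hk⟩ := hj
  have hBk : 0 < B k j := lt_of_le_of_ne (hB k j) hk.symm
  have hx' : ∀ j, 0 ≤ x j := fun j => (hx j).le
  have hload : 0 < (B *ᵥ x) k := (mul_pos hBk (hx j)).trans_le (mul_le_mulVec hB hx' k j)
  refine Finset.sum_pos' (fun i _ => ?_) ⟨k, Finset.mem_univ k, ?_⟩
  · exact mul_nonneg (mul_nonneg (by linarith [hq i])
      (Real.rpow_nonneg (mulVec_nonneg hB hx' i) _)) (hB i j)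
  · exact mul_pos (mul_pos (by linarith [hq k]) (Real.rpow_pos_of_pos hload _)) hBk

/-- Bernoulli's inequality at `u / v`: the graph of `t ^ r` lies above its tangent at `v`. -/
lemma rpow_sub_rpow_le {r u v : ℝ} (hr : 1 ≤ r) (hu : 0 ≤ u) (huv : u ≤ v) :
    v ^ r - u ^ r ≤ r * v ^ (r - 1) * (v - u) := by
  rcases (hu.trans huv).eq_or_lt with hv | hv
  · have : u = 0 := le_antisymm (hv ▸ huv) hu
    simp [← hv, this]
  · have h := one_add_mul_self_le_rpow_one_add (s := u / v - 1)
      (by linarith [div_nonneg hu hv.le]) hr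
    rw [add_sub_cancel, Real.div_rpow hu hv.le, le_div_iff₀ (Real.rpow_pos_of_pos hv r)] at h
    have hvr : v ^ r = v ^ (r - 1) * v := by
      rw [← Real.rpow_add_one hv.ne']; congr 1; ring
    have hexp : (1 + r * (u / v - 1)) * v ^ r = v ^ r - r * v ^ (r - 1) * (v - u) := by
      rw [hvr]; field_simp; ring
    linarith

lemma sum_loadGradient_mul (x y : Fin n → ℝ) :
    ∑ j, loadGradient q B x j * y j = ∑ k, q k * (B *ᵥ x) k ^ (q k - 1) * (B *ᵥ y) k := by
  simp only [loadGradient, Finset.sum_mul]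
  rw [Finset.sum_comm]
  refine Finset.sum_congr rfl fun k _ => ?_
  simp only [Matrix.mulVec, dotProduct, Finset.mul_sum, mul_assoc]

lemma loadPowerSum_sub_le (hq : ∀ k, 1 ≤ q k) (hB : ∀ k j, 0 ≤ B k j) {x y : Fin n → ℝ}
    (hx : ∀ j, 0 ≤ x j) (hxy : x ≤ y) :
    loadPowerSum q B y - loadPowerSum q B x ≤ ∑ j, loadGradient q B y j * (y j - x j) := by
  have h := sum_loadGradient_mul (q := q) (B := B) y (y - x)
  simp only [Pi.sub_apply] at h
  rw [h, loadPowerSum, loadPowerSum, ← Finset.sum_sub_distrib]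
  refine Finset.sum_le_sum fun k _ => ?_
  rw [Matrix.mulVec_sub, Pi.sub_apply]
  exact rpow_sub_rpow_le (hq k) (mulVec_nonneg hB hx k) (mulVec_mono hB hxy k)

/-- This includes `w = 0`, where division by zero gives `0` and the argument is `1`. -/
lemma one_le_potential_arg {w x : ℝ} (hw : 0 ≤ w) (hx : 0 ≤ x) :
    1 ≤ 1 + d * min x (2 * w) / w := by
  have : 0 ≤ d * min x (2 * w) / w := by positivity
  linarith

lemma potential_term_nonneg (hq : ∀ k, 1 ≤ q k) (hB : ∀ k j, 0 ≤ B k j) {w x : Fin n → ℝ}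
    (hw : ∀ j, 0 ≤ w j) (hx : ∀ j, 0 ≤ x j) (j : Fin n) :
    0 ≤ w j * loadGradient q B x j * Real.log (1 + d * min (x j) (2 * w j) / w j) :=
  mul_nonneg (mul_nonneg (hw j) (loadGradient_nonneg hq hB hx j))
    (Real.log_nonneg (one_le_potential_arg (hw j) (hx j)))

lemma potential_nonneg (hq : ∀ k, 1 ≤ q k) (hB : ∀ k j, 0 ≤ B k j) {w x : Fin n → ℝ}
    (hw : ∀ j, 0 ≤ w j) (hx : ∀ j, 0 ≤ x j) : 0 ≤ potential d q B w x :=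
  Finset.sum_nonneg fun j _ => potential_term_nonneg hq hB hw hx j

lemma potential_term_mono (hq : ∀ k, 1 ≤ q k) (hB : ∀ k j, 0 ≤ B k j) {w x y : Fin n → ℝ}
    (hw : ∀ j, 0 ≤ w j) (hx : ∀ j, 0 ≤ x j) (hxy : x ≤ y) (j : Fin n) :
    w j * loadGradient q B x j * Real.log (1 + d * min (x j) (2 * w j) / w j) ≤
      w j * loadGradient q B y j * Real.log (1 + d * min (y j) (2 * w j) / w j) := by
  have h1 := one_le_potential_arg (d := d) (hw j) (hx j)
  refine mul_le_mul (mul_le_mul_of_nonneg_left (loadGradient_mono hq hB hx hxy j) (hw j))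
    (Real.log_le_log (by linarith) ?_) (Real.log_nonneg h1)
    (mul_nonneg (hw j) (loadGradient_nonneg hq hB (fun i => (hx i).trans (hxy i)) j))
  have := hw j
  have := hxy j
  gcongr

lemma potential_mono (hq : ∀ k, 1 ≤ q k) (hB : ∀ k j, 0 ≤ B k j) {w x y : Fin n → ℝ}
    (hw : ∀ j, 0 ≤ w j) (hx : ∀ j, 0 ≤ x j) (hxy : x ≤ y) :
    potential d q B w x ≤ potential d q B w y :=
  Finset.sum_le_sum fun j _ => potential_term_mono hq hB hw hx hxy j

lemma continuousOn_potential (hq : ∀ k, 1 ≤ q k) {w x : Fin n → ℝ}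
    (hw : ∀ j, 0 ≤ w j) (hx : ∀ j, 0 ≤ x j) : ContinuousOn (potential d q B w) (Set.Ici x) := by
  refine continuousOn_finsetSum _ fun j _ => ContinuousOn.mul
    (continuousOn_const.mul (continuous_loadGradient hq j).continuousOn)
    (ContinuousOn.log (by fun_prop) fun y hy => ?_)
  have := one_le_potential_arg (d := d) (hw j) ((hx j).trans (hy j))
  linarith

/-- The truncation at `2 * w j` caps the argument of each logarithm by `1 + 2 * d ≤ (1 + d) ^ 2`. -/
lemma potential_le (hq : ∀ k, 1 ≤ q k) (hB : ∀ k j, 0 ≤ B k j) {w x : Fin n → ℝ}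
    (hw : ∀ j, 0 ≤ w j) (hx : ∀ j, 0 ≤ x j) :
    potential d q B w x ≤ 2 * Real.log (1 + d) * ∑ j, loadGradient q B x j * w j := by
  rw [Finset.mul_sum]
  refine Finset.sum_le_sum fun j _ => ?_
  have hg := loadGradient_nonneg hq hB hx j
  rcases (hw j).eq_or_lt with h0 | h0
  · simp [← h0]
  have harg : 1 + d * min (x j) (2 * w j) / w j ≤ (1 + (d : ℝ)) ^ 2 := by
    have : d * min (x j) (2 * w j) / w j ≤ d * (2 * w j) / w j := by
      gcongr
      exact min_le_right _ _
    have h2 : (d : ℝ) * (2 * w j) / w j = 2 * d := by field_simp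
    nlinarith [sq_nonneg (d : ℝ)]
  have hlog := Real.log_le_log (by linarith [one_le_potential_arg (d := d) (hw j) (hx j)]) harg
  rw [Real.log_pow] at hlog
  push_cast at hlog
  calc _ ≤ w j * loadGradient q B x j * (2 * Real.log (1 + d)) :=
        mul_le_mul_of_nonneg_left hlog (mul_nonneg h0.le hg)
    _ = _ := by ring

end Basic

/-! ### Serving one violated row at a cost charged to the potential. -/

section Step

variable {K n : ℕ} {d : ℕ} {q : Fin K → ℝ} {B : Matrix (Fin K) (Fin n) ℝ}

lemma IsRow.exists_ne_zero {a : Fin n → ℝ} (ha : IsRow d a) : ∃ j, a j ≠ 0 :=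
  Function.ne_iff.1 ha.ne_zero

lemma IsRow.sparsity_pos {a : Fin n → ℝ} (ha : IsRow d a) : 0 < d := by
  obtain ⟨j, hj⟩ := ha.exists_ne_zero
  exact ((Set.ncard_pos (Set.toFinite _)).2 ⟨j, hj⟩).trans_le ha.sparse

lemma IsRow.sum_support_inv_le {a : Fin n → ℝ} (ha : IsRow d a) :
    ∑ j, (if a j = 0 then 0 else 1 / (d : ℝ)) ≤ 1 := by
  have hd : (0 : ℝ) < d := by exact_mod_cast ha.sparsity_pos
  have hcard : ((Finset.univ.filter fun j => ¬ a j = 0).card : ℝ) ≤ d := by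
    have h := ha.sparse
    rw [Set.ncard_eq_toFinset_card'] at h
    have heq : Finset.univ.filter (fun j => ¬ a j = 0) = {j | a j ≠ 0}.toFinset := by
      ext j; simp
    rw [heq]
    exact_mod_cast h
  rw [Finset.sum_ite, Finset.sum_const_zero, zero_add, Finset.sum_const, nsmul_eq_mul]
  rw [mul_one_div, div_le_one hd]
  exact hcard

/-- The multiplicative update direction. -/
noncomputable def direction (d : ℕ) (q : Fin K → ℝ) (B : Matrix (Fin K) (Fin n) ℝ)
    (a x : Fin n → ℝ) (j : Fin n) : ℝ :=
  if a j = 0 then 0 else (a j * x j + 1 / d) / loadGradient q B x j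

lemma half_le_log_one_add {s : ℝ} (h0 : 0 ≤ s) (h1 : s ≤ 1) : s / 2 ≤ Real.log (1 + s) := by
  have h := Real.one_sub_inv_le_log_of_pos (x := 1 + s) (by linarith)
  refine le_trans ?_ h
  rw [inv_eq_one_div, div_le_iff₀ two_pos, sub_mul, one_mul, div_mul_eq_mul_div,
    le_sub_iff_add_le, ← le_sub_iff_add_le', div_le_iff₀ (by linarith)]
  nlinarith

/-- Growth of a single logarithmic term of the potential along the update direction. -/
lemma half_min_le_log_sub_log {D a x w g t : ℝ} (hD : 0 < D) (ha : 0 ≤ a) (hx : 0 < x)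
    (hg : 0 < g) (ht : 0 ≤ t) (hxw : x < w) (hstep : t * ((a * x + 1 / D) / g) ≤ x) :
    t / 2 * min (a * w) 1 ≤ w * g *
      (Real.log (1 + D * min (x + t * ((a * x + 1 / D) / g)) (2 * w) / w)
        - Real.log (1 + D * min x (2 * w) / w)) := by
  set δ := t * ((a * x + 1 / D) / g) with hδ
  have hw : 0 < w := hx.trans hxw
  have hδ0 : 0 ≤ δ := by positivity
  -- The step at most doubles `x < w`, so the truncation at `2 * w` is inactive at both ends.
  rw [min_eq_left (by linarith : x + δ ≤ 2 * w), min_eq_left (by linarith : x ≤ 2 * w)]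
  have hden : 0 < w + D * x := by positivity
  set s := D * δ / (w + D * x) with hs
  have hs0 : 0 ≤ s := by positivity
  have hs1 : s ≤ 1 := by
    rw [hs, div_le_one hden]
    nlinarith [mul_le_mul_of_nonneg_left hstep hD.le]
  have hlog : Real.log (1 + D * (x + δ) / w) - Real.log (1 + D * x / w) = Real.log (1 + s) := by
    rw [← Real.log_div (by positivity) (by positivity)]
    congr 1
    rw [hs]
    field_simp
    ring
  rw [hlog]
  refine le_trans ?_ (mul_le_mul_of_nonneg_left (half_le_log_one_add hs0 hs1)
    (mul_nonneg hw.le hg.le))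
  have hval : w * g * (s / 2) = t / 2 * (w * (D * a * x + 1) / (w + D * x)) := by
    rw [hs, hδ]
    field_simp
  rw [hval]
  refine mul_le_mul_of_nonneg_left ?_ (by linarith)
  -- Bound the minimum by `1` against `w` and by `a * w` against `D * x`.
  rw [le_div_iff₀ hden]
  have hmin1 : min (a * w) 1 * (D * x) ≤ a * w * (D * x) :=
    mul_le_mul_of_nonneg_right (min_le_left _ _) (by positivity)
  have hmin2 : min (a * w) 1 * w ≤ 1 * w :=
    mul_le_mul_of_nonneg_right (min_le_right _ _) hw.le
  nlinarith

/-- The coordinates in which `x` is below `w` carry at least a unit of truncated coverage. -/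
lemma one_le_sum_min {a x w : Fin n → ℝ} (ha : ∀ j, 0 ≤ a j) (hx : ∀ j, 0 ≤ x j)
    (hw : ∀ j, 0 ≤ w j) (hax : a ⬝ᵥ x < 1) (haw : 2 ≤ a ⬝ᵥ w) :
    1 ≤ ∑ j, (if x j < w j then min (a j * w j) 1 else 0) := by
  have hnn : ∀ j, 0 ≤ (if x j < w j then min (a j * w j) 1 else 0) := fun j => by
    split_ifs
    · exact le_min (mul_nonneg (ha j) (hw j)) zero_le_one
    · exact le_rfl
  -- One term truncated to `1` suffices; with none truncated, the sum dominates `a ⬝ᵥ w - a ⬝ᵥ x ≥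
  -- 1`.
  by_cases hbig : ∃ j, x j < w j ∧ 1 ≤ a j * w j
  · obtain ⟨j, hj, hj1⟩ := hbig
    have h := Finset.single_le_sum (f := fun j => if x j < w j then min (a j * w j) 1 else 0)
      (fun i _ => hnn i) (Finset.mem_univ j)
    simpa [hj, hj1] using h
  · push Not at hbig
    have h : a ⬝ᵥ w - a ⬝ᵥ x ≤ ∑ j, (if x j < w j then min (a j * w j) 1 else 0) := by
      unfold dotProduct
      rw [← Finset.sum_sub_distrib]
      refine Finset.sum_le_sum fun j _ => ?_
      have hj := mul_nonneg (ha j) (hx j)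
      split_ifs with hlt
      · rw [min_eq_left (hbig j hlt).le]
        linarith
      · linarith [mul_le_mul_of_nonneg_left (not_lt.1 hlt) (ha j)]
    linarith

/-- While a constraint is violated, a short move along the update direction increases the
objective by at most a constant times the increase of the potential, for every comparison
vector. -/
lemma exists_short_step (hq : ∀ k, 1 ≤ q k) (hB : ∀ k j, 0 ≤ B k j) {a x : Fin n → ℝ}
    (ha : IsRow d a) (hx : ∀ j, 0 < x j) (hcol : ∀ j, a j ≠ 0 → ∃ k, B k j ≠ 0)
    (hax : a ⬝ᵥ x < 1) :
    ∃ y, x ≤ y ∧ (∀ j, a j = 0 → y j = x j) ∧ a ⬝ᵥ x < a ⬝ᵥ y ∧ a ⬝ᵥ y ≤ 2 ∧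
      ∀ w : Fin n → ℝ, (∀ j, 0 ≤ w j) → 2 ≤ a ⬝ᵥ w →
        loadPowerSum q B y - loadPowerSum q B x ≤
          8 * (potential d q B w y - potential d q B w x) := by
  have hd : (0 : ℝ) < d := by exact_mod_cast ha.sparsity_pos
  have hx' : ∀ j, 0 ≤ x j := fun j => (hx j).le
  set v := direction d q B a x with hv
  have hg : ∀ j, a j ≠ 0 → 0 < loadGradient q B x j := fun j hj =>
    loadGradient_pos hq hB hx (hcol j hj)
  have hv0 : ∀ j, a j = 0 → v j = 0 := fun j hj => by simp [hv, direction, hj]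
  have hv1 : ∀ j, a j ≠ 0 → v j = (a j * x j + 1 / d) / loadGradient q B x j :=
    fun j hj => by simp [hv, direction, hj]
  have hvpos : ∀ j, a j ≠ 0 → 0 < v j := fun j hj => by
    rw [hv1 j hj]
    exact div_pos (add_pos_of_nonneg_of_pos (mul_nonneg (ha.nonneg j) (hx' j)) (by positivity))
      (hg j hj)
  have hvnn : ∀ j, 0 ≤ v j := fun j => by
    by_cases hj : a j = 0
    · exact (hv0 j hj).ge
    · exact (hvpos j hj).le
  -- By continuity, a short enough step at most doubles each coordinate and each gradient entry on
  -- the support.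
  obtain ⟨t, ⟨hsmall, hgrad⟩, ht⟩ : ∃ t : ℝ, ((∀ j, t * v j ≤ x j) ∧
      ∀ j, a j ≠ 0 → loadGradient q B (x + t • v) j ≤ 2 * loadGradient q B x j) ∧ 0 < t := by
    have h1 : ∀ᶠ t : ℝ in nhds 0, ∀ j, t * v j ≤ x j := Filter.eventually_all.2 fun j => by
      have hc : Continuous fun t : ℝ => t * v j := by fun_prop
      exact (hc.tendsto' 0 0 (zero_mul _)).eventually_le_const (hx j)
    have h2 : ∀ᶠ t : ℝ in nhds 0, ∀ j, a j ≠ 0 →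
        loadGradient q B (x + t • v) j ≤ 2 * loadGradient q B x j :=
      Filter.eventually_all.2 fun j => by
        by_cases hj : a j = 0
        · simp [hj]
        have hc : Continuous fun t : ℝ => loadGradient q B (x + t • v) j :=
          (continuous_loadGradient hq j).comp (by fun_prop)
        have := (hc.tendsto' 0 (loadGradient q B x j) (by simp)).eventually_le_const
          (by linarith [hg j hj] : loadGradient q B x j < 2 * loadGradient q B x j)
        exact this.mono fun t ht _ => ht
    exact (((h1.and h2).filter_mono nhdsWithin_le_nhds).and
      (self_mem_nhdsWithin (s := Set.Ioi (0 : ℝ)))).exists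
  set y := x + t • v with hy
  have hyj : ∀ j, y j = x j + t * v j := fun j => by simp [hy]
  have hxy : x ≤ y := fun j => by
    rw [hyj]
    linarith [mul_nonneg ht.le (hvnn j)]
  refine ⟨y, hxy, fun j hj => by simp [hyj, hv0 j hj], ?_, ?_, fun w hw haw => ?_⟩
  · obtain ⟨j, hj⟩ := ha.exists_ne_zero
    refine Finset.sum_lt_sum (fun i _ => mul_le_mul_of_nonneg_left (hxy i) (ha.nonneg i))
      ⟨j, Finset.mem_univ j, mul_lt_mul_of_pos_left ?_ ((ha.nonneg j).lt_of_ne' hj)⟩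
    rw [hyj]
    linarith [mul_pos ht (hvpos j hj)]
  · have : a ⬝ᵥ y ≤ a ⬝ᵥ (2 • x) := Finset.sum_le_sum fun j _ =>
      mul_le_mul_of_nonneg_left (by
        rw [hyj, Pi.smul_apply, two_nsmul]; linarith [hsmall j]) (ha.nonneg j)
    rw [dotProduct_smul, two_nsmul] at this
    linarith
  -- One factor 2 comes from the gradient at `y`, the other from `a ⬝ᵥ x < 1` plus at most `d`
  -- shares of `1 / d`.
  have hcost : loadPowerSum q B y - loadPowerSum q B x ≤ 4 * t := by
    refine (loadPowerSum_sub_le hq hB hx' hxy).trans ?_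
    have hterm : ∀ j, loadGradient q B y j * (y j - x j) ≤
        2 * t * (a j * x j + if a j = 0 then 0 else 1 / (d : ℝ)) := fun j => by
      rw [hyj, add_sub_cancel_left]
      by_cases hj : a j = 0
      · simp [hj, hv0 j hj]
      · rw [if_neg hj]
        have heq : loadGradient q B x j * v j = a j * x j + 1 / d := by
          rw [hv1 j hj, mul_div_cancel₀ _ (hg j hj).ne']
        have := mul_le_mul_of_nonneg_right (hgrad j hj) (mul_nonneg ht.le (hvnn j))
        calc _ ≤ _ := this
          _ = 2 * t * (loadGradient q B x j * v j) := by ring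
          _ = _ := by rw [heq]
    refine (Finset.sum_le_sum fun j _ => hterm j).trans ?_
    rw [← Finset.mul_sum, Finset.sum_add_distrib]
    have h1 := ha.sum_support_inv_le
    have h2 : ∑ j, a j * x j < 1 := hax
    nlinarith
  have hgain : t / 2 ≤ potential d q B w y - potential d q B w x := by
    have h1 := mul_le_mul_of_nonneg_left (one_le_sum_min ha.nonneg hx' hw hax haw)
      (by linarith : 0 ≤ t / 2)
    rw [mul_one, Finset.mul_sum] at h1
    refine h1.trans ?_
    unfold potential
    rw [← Finset.sum_sub_distrib]
    refine Finset.sum_le_sum fun j _ => ?_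
    have hmono := potential_term_mono (d := d) hq hB hw hx' hxy j
    split_ifs with hlt
    · by_cases hj : a j = 0
      · simpa [hj] using hmono
      have hstep := hsmall j
      rw [hv1 j hj] at hstep
      -- The gradient is frozen at `x`; its increase to `y` only helps.
      refine (half_min_le_log_sub_log hd (ha.nonneg j) (hx j) (hg j hj) ht.le hlt hstep).trans ?_
      rw [← hv1 j hj, ← hyj, mul_sub]
      have hlog := Real.log_nonneg
        (one_le_potential_arg (d := d) (hw j) ((hx' j).trans (hxy j)))
      have := mul_le_mul_of_nonneg_right (mul_le_mul_of_nonneg_left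
        (loadGradient_mono hq hB hx' hxy j) (hw j)) hlog
      linarith
    · simpa using hmono
  linarith

/-- A violated constraint whose support avoids the zero columns of `B` can be satisfied at a
cost bounded by the increase of the potential. -/
lemma exists_covering_step (hq : ∀ k, 1 ≤ q k) (hB : ∀ k j, 0 ≤ B k j) {a x : Fin n → ℝ}
    (ha : IsRow d a) (hx : ∀ j, 0 < x j) (hcol : ∀ j, a j ≠ 0 → ∃ k, B k j ≠ 0) :
    ∃ y, x ≤ y ∧ 1 ≤ a ⬝ᵥ y ∧
      ∀ w : Fin n → ℝ, (∀ j, 0 ≤ w j) → 2 ≤ a ⬝ᵥ w →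
        loadPowerSum q B y - loadPowerSum q B x ≤
          8 * (potential d q B w y - potential d q B w x) := by
  by_cases hax : 1 ≤ a ⬝ᵥ x
  · exact ⟨x, le_rfl, hax, fun w _ _ => by simp⟩
  have hx' : ∀ j, 0 ≤ x j := fun j => (hx j).le
  have hcdot : Continuous fun y : Fin n → ℝ => a ⬝ᵥ y := by unfold dotProduct; fun_prop
  let W := {w : Fin n → ℝ // (∀ j, 0 ≤ w j) ∧ 2 ≤ a ⬝ᵥ w}
  let T : W → Set (Fin n → ℝ) := fun w => {y ∈ Set.Ici x |
    loadPowerSum q B y - loadPowerSum q B x ≤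
      8 * (potential d q B w.1 y - potential d q B w.1 x)}
  -- Freezing the coordinates off the support of `a` and requiring `a ⬝ᵥ y ≤ 2` makes `S` bounded.
  let S : Set (Fin n → ℝ) :=
    Set.Ici x ∩ {y | ∀ j, a j = 0 → y j = x j} ∩ {y | a ⬝ᵥ y ≤ 2} ∩ ⋂ w, T w
  have hT : ∀ w, IsClosed (T w) := fun w =>
    isClosed_Ici.isClosed_le
      ((continuous_loadPowerSum hq).sub continuous_const).continuousOn
      (continuousOn_const.mul ((continuousOn_potential hq w.2.1 hx').sub continuousOn_const))
  have hS : IsClosed S := by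
    refine ((isClosed_Ici.inter ?_).inter (isClosed_le hcdot continuous_const)).inter
      (isClosed_iInter hT)
    simp only [Set.ofPred_forall]
    exact isClosed_iInter fun j => isClosed_iInter fun _ =>
      isClosed_eq (continuous_apply j) continuous_const
  have hsub : S ⊆ Set.Icc x (fun j => x j + 2 / a j) := by
    rintro y ⟨⟨⟨hxy, hfix⟩, hle⟩, -⟩
    refine ⟨hxy, fun j => ?_⟩
    by_cases hj : a j = 0
    · simp [hj, hfix j hj]
    · have hpos := (ha.nonneg j).lt_of_ne' hj
      have h1 : a j * y j ≤ a ⬝ᵥ y :=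
        Finset.single_le_sum (f := fun i => a i * y i)
          (fun i _ => mul_nonneg (ha.nonneg i) ((hx' i).trans (hxy i))) (Finset.mem_univ j)
      have h2 : y j ≤ 2 / a j := by
        rw [le_div_iff₀ hpos]
        have : a ⬝ᵥ y ≤ 2 := hle
        linarith
      show y j ≤ x j + 2 / a j
      linarith [hx' j]
  have hxS : x ∈ S := by
    refine ⟨⟨⟨Set.self_mem_Ici, fun _ _ => rfl⟩, ?_⟩,
      Set.mem_iInter.2 fun w => ⟨Set.self_mem_Ici, by simp⟩⟩
    show a ⬝ᵥ x ≤ 2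
    linarith [not_le.1 hax]
  obtain ⟨y, hyS, hmax⟩ := (isCompact_Icc.of_isClosed_subset hS hsub).exists_isMaxOn ⟨x, hxS⟩
    hcdot.continuousOn
  have hyT := hyS
  obtain ⟨⟨⟨hxy, hfix⟩, hle⟩, hpot⟩ := hyT
  have hxy : x ≤ y := hxy
  rw [Set.mem_iInter] at hpot
  refine ⟨y, hxy, ?_, fun w hw haw => (hpot ⟨w, hw, haw⟩).2⟩
  -- If the maximiser of `a ⬝ᵥ y` still violated the row, a short step from it would stay in `S`,
  -- since the increments telescope, and beat it.
  by_contra hlt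
  obtain ⟨z, hyz, hfix', hgt, hle', hpot'⟩ := exists_short_step hq hB ha
    (fun j => (hx j).trans_le (hxy j)) hcol (not_le.1 hlt)
  have hzS : z ∈ S := by
    refine ⟨⟨⟨hxy.trans hyz, fun j hj => (hfix' j hj).trans (hfix j hj)⟩, hle'⟩,
      Set.mem_iInter.2 fun w => ⟨hxy.trans hyz, ?_⟩⟩
    have h1 := (hpot w).2
    have h2 := hpot' w.1 w.2.1 w.2.2
    show _ ≤ _
    linarith
  exact (not_lt.2 (hmax hzS)) hgt

end Step

/-! ### The online algorithm and its invariant. -/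

section Invariant

variable {K n : ℕ} {d : ℕ} {q : Fin K → ℝ} {B : Matrix (Fin K) (Fin n) ℝ}

/-- The property maintained by the online algorithm: the current solution is feasible, it either
has zero load or is positive in every coordinate, and its cost is controlled by the potential. -/
structure OnlineInvariant (d : ℕ) (q : Fin K → ℝ) (B : Matrix (Fin K) (Fin n) ℝ)
    (rows : List (Fin n → ℝ)) (x : Fin n → ℝ) : Prop where
  feasible : IsFeasible rows x
  load_zero_or_pos : B *ᵥ x = 0 ∨ ∀ j, 0 < x j
  cost : ∀ z, IsFeasible rows z →
    loadPowerSum q B x ≤ loadPowerSum q B z + 8 * potential d q B (2 • z) x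

lemma IsFeasible.of_append {rows : List (Fin n → ℝ)} {a x : Fin n → ℝ}
    (h : IsFeasible (rows ++ [a]) x) : IsFeasible rows x :=
  ⟨h.nonneg, fun b hb => h.covers b (List.mem_append_left _ hb)⟩

lemma IsFeasible.last {rows : List (Fin n → ℝ)} {a x : Fin n → ℝ}
    (h : IsFeasible (rows ++ [a]) x) : 1 ≤ a ⬝ᵥ x :=
  h.covers a (by simp)

lemma IsFeasible.append {rows : List (Fin n → ℝ)} {a x y : Fin n → ℝ}
    (h : IsFeasible rows x) (hrows : ∀ b ∈ rows, IsRow d b) (hxy : x ≤ y) (hay : 1 ≤ a ⬝ᵥ y) :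
    IsFeasible (rows ++ [a]) y := by
  refine ⟨fun j => (h.nonneg j).trans (hxy j), fun b hb => ?_⟩
  rcases List.mem_append.1 hb with hb | hb
  · exact (h.covers b hb).trans (Finset.sum_le_sum fun j _ =>
      mul_le_mul_of_nonneg_left (hxy j) ((hrows b hb).nonneg j))
  · rw [List.mem_singleton.1 hb]
    exact hay

lemma two_smul_nonneg {z : Fin n → ℝ} (hz : ∀ j, 0 ≤ z j) (j : Fin n) : 0 ≤ (2 • z) j := by
  rw [Pi.smul_apply, two_nsmul]
  linarith [hz j]

lemma OnlineInvariant.nil (hq : ∀ k, 1 ≤ q k) (hB : ∀ k j, 0 ≤ B k j) :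
    OnlineInvariant d q B [] 0 where
  feasible := ⟨fun _ => le_rfl, by simp⟩
  load_zero_or_pos := Or.inl (Matrix.mulVec_zero B)
  cost z hz := by
    rw [loadPowerSum_eq_zero hq (Matrix.mulVec_zero B)]
    have h1 := loadPowerSum_nonneg (q := q) hB hz.nonneg
    have h2 := potential_nonneg (d := d) hq hB (two_smul_nonneg hz.nonneg)
      (x := 0) (fun _ => le_rfl)
    linarith

/-- A constraint all of whose columns carry load forces a positive cost, and hence a small
positive start is affordable. -/
lemma exists_pos_loadPowerSum_le (hq : ∀ k, 1 ≤ q k) (hB : ∀ k j, 0 ≤ B k j) {a : Fin n → ℝ}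
    (ha : IsRow d a) (hcol : ∀ j, a j ≠ 0 → ∃ k, B k j ≠ 0) :
    ∃ ε : ℝ, 0 < ε ∧ ∀ z : Fin n → ℝ, (∀ j, 0 ≤ z j) → 1 ≤ a ⬝ᵥ z →
      loadPowerSum q B (fun _ => ε) ≤ loadPowerSum q B z := by
  obtain ⟨i, -⟩ := ha.exists_ne_zero
  have hn : (0 : ℝ) < n := by exact_mod_cast i.pos
  have hbound : ∀ j, a j ≠ 0 → ∃ m : ℝ, 0 < m ∧ ∀ z : Fin n → ℝ, (∀ j, 0 ≤ z j) →
      1 / (n : ℝ) ≤ a j * z j → m ≤ loadPowerSum q B z := fun j hj => by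
    obtain ⟨k, hk⟩ := hcol j hj
    have haj : 0 < a j := (ha.nonneg j).lt_of_ne' hj
    have hBk : 0 < B k j := (hB k j).lt_of_ne' hk
    have hm : 0 < B k j * (1 / n / a j) := by positivity
    refine ⟨(B k j * (1 / n / a j)) ^ q k, Real.rpow_pos_of_pos hm _, fun z hz hjz => ?_⟩
    have hload : B k j * (1 / n / a j) ≤ (B *ᵥ z) k := by
      refine le_trans (mul_le_mul_of_nonneg_left ?_ hBk.le) (mul_le_mulVec hB hz k j)
      rwa [div_le_iff₀' haj]
    refine (Real.rpow_le_rpow hm.le hload (by linarith [hq k])).trans ?_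
    exact Finset.single_le_sum (f := fun k => (B *ᵥ z) k ^ q k)
      (fun i _ => Real.rpow_nonneg (mulVec_nonneg hB hz i) _) (Finset.mem_univ k)
  have hcont : Continuous fun ε : ℝ => loadPowerSum q B (fun _ : Fin n => ε) :=
    (continuous_loadPowerSum hq).comp (by fun_prop)
  have hzero : loadPowerSum q B (fun _ : Fin n => (0 : ℝ)) = 0 :=
    loadPowerSum_eq_zero hq (Matrix.mulVec_zero B)
  have hev : ∀ᶠ ε : ℝ in nhds 0, ∀ j, a j ≠ 0 → ∀ z : Fin n → ℝ, (∀ j, 0 ≤ z j) →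
      1 / (n : ℝ) ≤ a j * z j → loadPowerSum q B (fun _ : Fin n => ε) ≤ loadPowerSum q B z :=
    Filter.eventually_all.2 fun j => by
      by_cases hj : a j = 0
      · simp [hj]
      obtain ⟨m, hm, hmz⟩ := hbound j hj
      exact ((hcont.tendsto' 0 0 hzero).eventually_le_const hm).mono
        fun ε hε _ z hz hjz => hε.trans (hmz z hz hjz)
  obtain ⟨ε, hε, hpos⟩ := ((hev.filter_mono nhdsWithin_le_nhds).and
    (self_mem_nhdsWithin (s := Set.Ioi (0 : ℝ)))).exists
  refine ⟨ε, hpos, fun z hz haz => ?_⟩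
  -- Pigeonhole: some coordinate contributes at least `1 / n` to `a ⬝ᵥ z ≥ 1`.
  obtain ⟨j, hj⟩ : ∃ j, 1 / (n : ℝ) ≤ a j * z j := by
    by_contra! hlt
    have hsum : ∑ j, a j * z j < ∑ _j : Fin n, 1 / (n : ℝ) :=
      Finset.sum_lt_sum_of_nonempty ⟨i, Finset.mem_univ i⟩ fun j _ => hlt j
    rw [Finset.sum_const, Finset.card_univ, Fintype.card_fin, nsmul_eq_mul,
      mul_one_div_cancel hn.ne'] at hsum
    exact absurd haz (not_le.2 hsum)
  refine hε j (fun h0 => ?_) z hz hj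
  rw [h0, zero_mul] at hj
  exact absurd hj (not_le.2 (by positivity))

/-- If the support of `a` meets a zero column of `B`, raising that coordinate is free. Otherwise
`exists_covering_step` applies, preceded by an `ε`-start if the load is still zero; the start is
paid by the term `loadPowerSum q B z` of the invariant. -/
lemma OnlineInvariant.exists_append (hq : ∀ k, 1 ≤ q k) (hB : ∀ k j, 0 ≤ B k j)
    {rows : List (Fin n → ℝ)} {x a : Fin n → ℝ} (hx : OnlineInvariant d q B rows x)
    (hrows : ∀ b ∈ rows, IsRow d b) (ha : IsRow d a) :
    ∃ y, x ≤ y ∧ OnlineInvariant d q B (rows ++ [a]) y := by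
  have hx0 := hx.feasible.nonneg
  by_cases hcol : ∀ j, a j ≠ 0 → ∃ k, B k j ≠ 0
  · obtain ⟨x', hxx', hpos, hcost⟩ : ∃ x', x ≤ x' ∧ (∀ j, 0 < x' j) ∧
        ∀ z, IsFeasible (rows ++ [a]) z →
          loadPowerSum q B x' ≤ loadPowerSum q B z + 8 * potential d q B (2 • z) x' := by
      rcases hx.load_zero_or_pos with hzero | hpos
      · obtain ⟨ε, hε, hle⟩ := exists_pos_loadPowerSum_le hq hB ha hcol
        have hpos : ∀ j, 0 < (x + (fun _ => ε) : Fin n → ℝ) j := fun j => add_pos_of_nonneg_of_pos (hx0 j) hε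
        refine ⟨x + fun _ => ε, fun j => le_add_of_nonneg_right hε.le, hpos, fun z hz => ?_⟩
        have heq : loadPowerSum q B (x + fun _ => ε) = loadPowerSum q B (fun _ => ε) := by
          simp only [loadPowerSum, Matrix.mulVec_add, hzero, zero_add]
        rw [heq]
        have h1 := hle z hz.nonneg hz.last
        have h2 := potential_nonneg (d := d) hq hB (two_smul_nonneg hz.nonneg)
          (fun j => (hpos j).le)
        linarith
      · exact ⟨x, le_rfl, hpos, fun z hz => hx.cost z hz.of_append⟩
    obtain ⟨y, hxy, hay, hstep⟩ := exists_covering_step hq hB ha hpos hcol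
    refine ⟨y, hxx'.trans hxy, hx.feasible.append hrows (hxx'.trans hxy) hay,
      Or.inr fun j => (hpos j).trans_le (hxy j), fun z hz => ?_⟩
    have h1 := hcost z hz
    have h2 := hstep (2 • z) (two_smul_nonneg hz.nonneg) (by
      rw [dotProduct_smul, two_nsmul]
      linarith [hz.last])
    linarith
  · push Not at hcol
    obtain ⟨j, hj, hBj⟩ := hcol
    have haj : 0 < a j := (ha.nonneg j).lt_of_ne' hj
    set y := x + Pi.single j (1 / a j) with hy
    have hsingle : 0 ≤ (Pi.single j (1 / a j) : Fin n → ℝ) := Pi.single_nonneg.2 (by positivity)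
    have hxy : x ≤ y := le_add_of_nonneg_right hsingle
    have hload : B *ᵥ y = B *ᵥ x := by
      rw [hy, Matrix.mulVec_add, Matrix.mulVec_single]
      ext k
      simp [hBj k]
    refine ⟨y, hxy, hx.feasible.append hrows hxy ?_, ?_, fun z hz => ?_⟩
    · have hax : 0 ≤ a ⬝ᵥ x := Finset.sum_nonneg fun i _ => mul_nonneg (ha.nonneg i) (hx0 i)
      rw [hy, dotProduct_add, dotProduct_single, mul_one_div_cancel hj]
      linarith
    · rw [hload]
      exact hx.load_zero_or_pos.imp id fun h i => (h i).trans_le (hxy i)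
    · have h1 := hx.cost z hz.of_append
      have h2 := potential_mono (d := d) hq hB (two_smul_nonneg hz.nonneg) hx0 hxy
      have h3 : loadPowerSum q B y = loadPowerSum q B x := by simp only [loadPowerSum, hload]
      linarith

/-- An invariant that can be re-established after each arrival by increasing the solution is
maintained by some deterministic online algorithm. -/
lemma exists_algorithm_of_invariant {P : List (Fin n → ℝ) → (Fin n → ℝ) → Prop}
    {x₀ : Fin n → ℝ} (hnil : P [] x₀)
    (hstep : ∀ rows x a, P rows x → (∀ b ∈ rows, IsRow d b) → IsRow d a →
      ∃ y, x ≤ y ∧ P (rows ++ [a]) y) :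
    ∃ alg : Algorithm n, (∀ rows, (∀ b ∈ rows, IsRow d b) → P rows (alg rows)) ∧
      ∀ rows, (∀ b ∈ rows, IsRow d b) → ∀ a, IsRow d a → alg rows ≤ alg (rows ++ [a]) := by
  classical
  let next : List (Fin n → ℝ) → (Fin n → ℝ) → (Fin n → ℝ) → (Fin n → ℝ) := fun rows x a =>
    if h : ∃ y, x ≤ y ∧ P (rows ++ [a]) y then h.choose else x
  -- Recursion on the reversed list puts the latest row at the head, so only earlier rows determine
  -- the previous solution.
  let rev : Algorithm n := fun l => List.rec x₀ (fun a l x => next l.reverse x a) l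
  let alg : Algorithm n := fun rows => rev rows.reverse
  have halg : ∀ rows a, alg (rows ++ [a]) = next rows (alg rows) a := fun rows a => by
    simp only [alg, rev, List.reverse_append, List.reverse_singleton, List.singleton_append,
      List.reverse_reverse]
  have hnext : ∀ rows x a, (∃ y, x ≤ y ∧ P (rows ++ [a]) y) →
      x ≤ next rows x a ∧ P (rows ++ [a]) (next rows x a) := fun rows x a h => by
    simp only [next, dif_pos h]
    exact h.choose_spec
  have hP : ∀ rows, (∀ b ∈ rows, IsRow d b) → P rows (alg rows) := fun rows => by
    induction rows using List.reverseRecOn with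
    | nil => exact fun _ => hnil
    | append_singleton rows a ih =>
      intro h
      have hrows : ∀ b ∈ rows, IsRow d b := fun b hb => h b (List.mem_append_left _ hb)
      rw [halg]
      exact (hnext _ _ _ (hstep _ _ _ (ih hrows) hrows (h a (by simp)))).2
  refine ⟨alg, hP, fun rows hrows a ha => ?_⟩
  rw [halg]
  exact (hnext _ _ _ (hstep _ _ _ (hP rows hrows) hrows ha)).1

/-! ### From the gradient bound to the competitive ratio. -/

lemma mul_rpow_sub_one_mul_le {r u v L : ℝ} (hr : 1 ≤ r) (hu : 0 ≤ u) (hv : 0 ≤ v)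
    (hL : 0 ≤ L) : L * (u ^ (r - 1) * v) ≤ u ^ r / 2 + (2 * L * v) ^ r / 2 := by
  have hLv : 0 ≤ 2 * L * v := by positivity
  have hpow : ∀ {s : ℝ}, 0 ≤ s → s ^ r = s ^ (r - 1) * s := fun {s} hs => by
    rw [← Real.rpow_add_one' hs (by linarith), sub_add_cancel]
  have h1 := Real.rpow_nonneg hu (r - 1)
  have h2 := Real.rpow_nonneg hLv (r - 1)
  rw [hpow hu, hpow hLv]
  have h3 := mul_nonneg h1 hu
  have h4 := mul_nonneg h2 hLv
  -- The left side is `u ^ (r - 1) * (2 * L * v) / 2`, at most half the `r`-th power of the larger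
  -- of `u` and `2 * L * v`.
  rcases le_total (2 * L * v) u with h | h
  · nlinarith [mul_le_mul_of_nonneg_left h h1]
  · nlinarith [mul_le_mul_of_nonneg_right (Real.rpow_le_rpow hu h (by linarith : 0 ≤ r - 1)) hLv]

/-- Absorbing half of the cost of `x` leaves the factor `2 + (2 * L) ^ p` with `L = c * p`, and `2 ≤
(2 * L) ^ p` and `2 ≤ 2 ^ p` turn it into `(4 * L) ^ p`. Since `2 * L ≥ 1`, all exponents `q k` may
be raised to `p` in the constant. -/
lemma loadPowerSum_le_of_gradient_bound {p c : ℝ} (hp : 1 ≤ p) (hq : ∀ k, 1 ≤ q k)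
    (hqp : ∀ k, q k ≤ p) (hB : ∀ k j, 0 ≤ B k j) {x z : Fin n → ℝ} (hx : ∀ j, 0 ≤ x j)
    (hz : ∀ j, 0 ≤ z j) (hc : 1 ≤ c * p)
    (h : loadPowerSum q B x ≤ loadPowerSum q B z + c * ∑ j, loadGradient q B x j * z j) :
    loadPowerSum q B x ≤ (4 * (c * p)) ^ p * loadPowerSum q B z := by
  set L := c * p with hL
  have hc0 : 0 < c := by
    by_contra hneg
    nlinarith [not_lt.1 hneg]
  have hsum : c * ∑ j, loadGradient q B x j * z j ≤
      loadPowerSum q B x / 2 + (2 * L) ^ p * loadPowerSum q B z / 2 := by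
    rw [sum_loadGradient_mul, loadPowerSum, loadPowerSum, Finset.mul_sum, Finset.mul_sum,
      Finset.sum_div, Finset.sum_div, ← Finset.sum_add_distrib]
    refine Finset.sum_le_sum fun k _ => ?_
    have hu := mulVec_nonneg hB hx k
    have hv := mulVec_nonneg hB hz k
    have huv : 0 ≤ (B *ᵥ x) k ^ (q k - 1) * (B *ᵥ z) k := mul_nonneg (Real.rpow_nonneg hu _) hv
    have h1 : c * (q k * (B *ᵥ x) k ^ (q k - 1) * (B *ᵥ z) k) ≤
        L * ((B *ᵥ x) k ^ (q k - 1) * (B *ᵥ z) k) := by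
      rw [mul_assoc, ← mul_assoc]
      exact mul_le_mul_of_nonneg_right (mul_le_mul_of_nonneg_left (hqp k) hc0.le) huv
    have h2 := mul_rpow_sub_one_mul_le (hq k) hu hv (by linarith : 0 ≤ L)
    have h3 : (2 * L * (B *ᵥ z) k) ^ q k ≤ (2 * L) ^ p * (B *ᵥ z) k ^ q k := by
      rw [Real.mul_rpow (by linarith) hv]
      exact mul_le_mul_of_nonneg_right
        (Real.rpow_le_rpow_of_exponent_le (by linarith) (hqp k)) (Real.rpow_nonneg hv _)
    linarith
  have hz0 := loadPowerSum_nonneg (q := q) hB hz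
  have hfour : (4 * L) ^ p = 2 ^ p * (2 * L) ^ p := by
    rw [← Real.mul_rpow (by norm_num) (by linarith)]
    congr 1
    ring
  have htwo : (2 : ℝ) ≤ 2 ^ p := by
    simpa using Real.rpow_le_rpow_of_exponent_le (by norm_num : (1 : ℝ) ≤ 2) hp
  have htwoL : 2 ≤ (2 * L) ^ p :=
    htwo.trans (Real.rpow_le_rpow (by norm_num) (by linarith) (by linarith))
  have h1 := mul_le_mul_of_nonneg_right htwoL hz0
  have h2 := mul_le_mul_of_nonneg_right htwo (mul_nonneg (by linarith : 0 ≤ (2 * L) ^ p) hz0)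
  rw [hfour, mul_assoc]
  linarith

/-- The competitive guarantee for sums of powers of loads with exponents between `1` and `p`. -/
theorem exists_isCompetitive_loadPowerSum {p : ℝ} (hp : 1 ≤ p) (hq : ∀ k, 1 ≤ q k)
    (hqp : ∀ k, q k ≤ p) (hB : ∀ k j, 0 ≤ B k j) :
    ∃ alg : Algorithm n,
      IsCompetitive d (loadPowerSum q B) ((128 * p * Real.log (1 + (d : ℝ))) ^ p) alg := by
  obtain ⟨alg, hinv, hmono⟩ := exists_algorithm_of_invariant (d := d)
    (P := OnlineInvariant d q B) (OnlineInvariant.nil hq hB)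
    fun rows x a hx hrows ha => hx.exists_append hq hB hrows ha
  refine ⟨alg, fun rows hrows => (hinv rows hrows).feasible, hmono, fun rows hrows z hz => ?_⟩
  have hx := hinv rows hrows
  -- For `d = 0` the ratio is `0`, but no row can arrive, and comparison with `0` shows that the
  -- solution costs nothing.
  rcases Nat.eq_zero_or_pos d with hd | hd
  · have hnil : rows = [] := by
      refine List.eq_nil_iff_forall_not_mem.2 fun a ha => ?_
      exact (hrows a ha).sparsity_pos.ne' hd
    subst hnil hd
    have h := hx.cost 0 ⟨fun _ => le_rfl, by simp⟩
    rw [loadPowerSum_eq_zero (x := 0) hq (Matrix.mulVec_zero B)] at h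
    have hpot : potential 0 q B (2 • 0) (alg []) = 0 := by simp [potential]
    rw [hpot, mul_zero, add_zero] at h
    refine h.trans (mul_nonneg (Real.rpow_nonneg ?_ _) (loadPowerSum_nonneg hB hz.nonneg))
    simp
  · have hlog : 1 / 2 ≤ Real.log (1 + (d : ℝ)) := by
      have hd1 : (1 : ℝ) ≤ d := by exact_mod_cast hd
      have := Real.log_le_log (by norm_num : (0 : ℝ) < 2) (by linarith : (2 : ℝ) ≤ 1 + d)
      linarith [Real.log_two_gt_d9]
    -- Here `32 = 8 * 2 * 2`: the charging constant, the bound on the logarithms, and `w = 2 • z`.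
    have h := loadPowerSum_le_of_gradient_bound (c := 32 * Real.log (1 + (d : ℝ))) hp hq hqp hB
      hx.feasible.nonneg hz.nonneg (by nlinarith) (by
        refine (hx.cost z hz).trans (add_le_add_right ?_ _)
        have hpot := potential_le (d := d) hq hB (two_smul_nonneg hz.nonneg) hx.feasible.nonneg
        have heq : ∑ j, loadGradient q B (alg rows) j * (2 • z) j =
            2 * ∑ j, loadGradient q B (alg rows) j * z j := by
          rw [Finset.mul_sum]
          refine Finset.sum_congr rfl fun j _ => ?_
          rw [Pi.smul_apply, two_nsmul]
          ring
        rw [heq] at hpot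
        linarith)
    have heq : 4 * (32 * Real.log (1 + (d : ℝ)) * p) = 128 * p * Real.log (1 + d) := by ring
    rwa [heq] at h

lemma loadNorm_eq_rpow {p : ℝ} (hp : 1 ≤ p) (hB : ∀ k j, 0 ≤ B k j) {x : Fin n → ℝ}
    (hx : ∀ j, 0 ≤ x j) : loadNorm p B x = loadPowerSum (fun _ => p) B x ^ (1 / p) := by
  have hp0 : (ENNReal.ofReal p).toReal = p := ENNReal.toReal_ofReal (by linarith)
  rw [loadNorm, PiLp.norm_eq_sum (by rw [hp0]; linarith), hp0, loadPowerSum]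
  congr 1
  refine Finset.sum_congr rfl fun k _ => ?_
  rw [Real.norm_of_nonneg (mulVec_nonneg hB hx k)]

lemma IsCompetitive.loadNorm {p c : ℝ} (hp : 1 ≤ p) (hc : 0 ≤ c) (hB : ∀ k j, 0 ≤ B k j)
    {alg : Algorithm n} (h : IsCompetitive d (loadPowerSum (fun _ => p) B) (c ^ p) alg) :
    IsCompetitive d (OnlineCovering.loadNorm p B) c alg where
  feasible := h.feasible
  monotone := h.monotone
  competitive rows hrows z hz := by
    have hx := (h.feasible rows hrows).nonneg
    rw [loadNorm_eq_rpow hp hB hx, loadNorm_eq_rpow hp hB hz.nonneg]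
    refine (Real.rpow_le_rpow (loadPowerSum_nonneg hB hx) (h.competitive rows hrows z hz)
      (by positivity)).trans_eq ?_
    rw [Real.mul_rpow (Real.rpow_nonneg hc _) (loadPowerSum_nonneg hB hz.nonneg), one_div,
      Real.rpow_rpow_inv hc (by linarith)]

end Invariant

end OnlineCovering

theorem mainTheorem4 :
    ∃ C : ℝ, 0 < C ∧
      (∀ (p : ℝ) (_ : 1 ≤ p) (n K d : ℕ) (B : Matrix (Fin K) (Fin n) ℝ)
          (_ : ∀ k j, 0 ≤ B k j),
        ∃ alg : OnlineCovering.Algorithm n,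
          OnlineCovering.IsCompetitive d (OnlineCovering.loadNorm p B)
            (C * p * Real.log (1 + (d : ℝ))) alg) ∧
      (∀ (n K d : ℕ) (q : Fin K → ℝ) (_ : ∀ k, 1 ≤ q k) (p : ℝ)
          (_ : IsGreatest (Set.range q) p) (B : Matrix (Fin K) (Fin n) ℝ)
          (_ : ∀ k j, 0 ≤ B k j),
        ∃ alg : OnlineCovering.Algorithm n,
          OnlineCovering.IsCompetitive d (OnlineCovering.loadPowerSum q B)
            ((C * p * Real.log (1 + (d : ℝ))) ^ p) alg) := by
  refine ⟨128, by norm_num, fun p hp n K d B hB => ?_, fun n K d q hq p hgreatest B hB => ?_⟩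
  · obtain ⟨alg, halg⟩ := OnlineCovering.exists_isCompetitive_loadPowerSum (d := d) hp
      (q := fun _ => p) (fun _ => hp) (fun _ => le_rfl) hB
    have hlog : 0 ≤ Real.log (1 + (d : ℝ)) := Real.log_nonneg (by simp)
    exact ⟨alg, halg.loadNorm hp (by positivity) hB⟩
  · obtain ⟨k, hk⟩ := hgreatest.1
    exact OnlineCovering.exists_isCompetitive_loadPowerSum (hk ▸ hq k) hq
      (fun k => hgreatest.2 ⟨k, rfl⟩) hB
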